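/- A poset is *representable* if it is order-isomorphic to the set of prime ideals, ordered by inclusion, of a bounded distributive lattice. An *order component* of a poset $(X;\le)$ is an equivalence class, with the induced order, of the transitive closure of the relation "$x\le y$ or $y\le x$". The *interval topology* of a poset has the sets $X\setminus\{y: y\le x\}$ and $X\setminus\{y: y\ge x\}$ ($x\in X$) as an open subbase. A *Priestley topology* on a poset is a compact topology such that, whenever $x\not\ge y$, there is a clopen decreasing set $U$ with $x\in U$ and $y\notin U$. **Theorem.** 1. If every order component of a poset $X$ is representable, then $X$ is representable. 2. Every order component of a representable poset is compact in its own interval topology. 3. There exists a representable poset with an order component that is not representable. More precisely, for 3, let $P=\{p\}\cup\{p_{i_0,\dots,i_n}: n\ge 0,\ i_0,\dots,i_n\in\mathbb N\}$ (with $\mathbb N\ni 0$), all these points being distinct, with the strict order consisting exactly of the following relations, for all $r\ge 0$ and all indices in $\mathbb N$: - $p<p_i$; - $p_{i_0,\dots,i_{2r-1},i}<p_{i_0,\dots,i_{2r-1},j}$ for $j<i$; - $p_{i_0,\dots,i_{2r},i}<p_{i_0,\dots,i_{2r},j}$ for $i<j$; - $p_{i_0,\dots,i_{2r-1},m,i}<p_{i_0,\dots,i_{2r-1},k}$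 for $k\le m$; - $p_{i_0,\dots,i_{2r},k}<p_{i_0,\dots,i_{2r},m,i}$ for $k\le m$ (for $r=0$ the list $i_0,\dots,i_{2r-1}$ is empty). Then $P$ is a countably infinite poset with a single order component. Let $C$ be the set of all decreasing subsets of $\mathbb Q\cap(0,1)$, with the interval topology $\tau$ of $(C;\subseteq)$. There is a partial order $\preceq$ on $C$ such that $\tau$ is a Priestley topology on $(C;\preceq)$, the poset $(C;\preceq)$ is representable, and some order component of $(C;\preceq)$ is order-isomorphic to $P$. But there is no Priestley topology on $P$, and $P$ is not representable. -/

import Mathlib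

universe u

/-- `X` is representable: it is order-isomorphic to the set of prime ideals, ordered by inclusion,
of some bounded distributive lattice (the one-element lattice, which has no prime ideal, is
allowed). Every such lattice is isomorphic to a lattice of subsets of `X`, so that it is no
restriction to look for it in the universe of `X`. -/
def Representable (X : Type u) [PartialOrder X] : Prop :=
  ∃ (L : Type u) (_ : DistribLattice L) (_ : BoundedOrder L),
    Nonempty (X ≃o {I : Order.Ideal L // I.IsPrime})

/-- The order component of `x`: its class under the transitive closure of the relation of being
comparable. As a subtype of `X` it carries the induced order. -/
def orderComponent {X : Type*} [PartialOrder X] (x : X) : Set X :=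
  {y | Relation.TransGen (fun a b : X => a ≤ b ∨ b ≤ a) x y}

/-- The interval topology: the complements of the sets `(x]` and of the sets `[x)` form an open
subbase. -/
@[reducible]
def intervalTopology (X : Type*) [PartialOrder X] : TopologicalSpace X :=
  TopologicalSpace.generateFrom
    (Set.range (fun x : X => (Set.Iic x)ᶜ) ∪ Set.range (fun x : X => (Set.Ici x)ᶜ))

/-- The topology `τ` makes the poset `X` a Priestley space, that is, a compact totally
order-disconnected space. (`PriestleySpace` does not include compactness.) -/
def IsPriestleyTopology {X : Type*} [PartialOrder X] (τ : TopologicalSpace X) : Prop :=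
  @CompactSpace X τ ∧ @PriestleySpace X _ τ

/-- The set of all decreasing subsets of the rational interval `(0, 1)`. -/
def CutSpace : Type := LowerSet (Set.Ioo (0 : ℚ) 1)

/-- The topology of `CutSpace` is the interval topology of the inclusion order. The inclusion order
itself is not made an instance, since another order is going to be put on this space. -/
instance CutSpace.instTopologicalSpace : TopologicalSpace CutSpace :=
  intervalTopology (LowerSet (Set.Ioo (0 : ℚ) 1))

/-- The points `p` and `p_{i₀,…,iₙ}`. The index list is stored with its last entry first: `⟨[]⟩` is
`p`, and `⟨[iₙ, …, i₀]⟩` is `p_{i₀,…,iₙ}`. -/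
structure TreePoint : Type where
  index : List ℕ

namespace TreePoint

/-- The strict order, on index lists whose last entry comes first. -/
inductive Lt : List ℕ → List ℕ → Prop
  /-- `p < p_i` -/
  | root (i : ℕ) : Lt [] [i]
  /-- `p_{i₀,…,i_{2r-1},i} < p_{i₀,…,i_{2r-1},j}` for `j < i` -/
  | even_sibling (l : List ℕ) (i j : ℕ) (hl : Even l.length) (h : j < i) : Lt (i :: l) (j :: l)
  /-- `p_{i₀,…,i_{2r},i} < p_{i₀,…,i_{2r},j}` for `i < j` -/
  | odd_sibling (l : List ℕ) (i j : ℕ) (hl : Odd l.length) (h : i < j) : Lt (i :: l) (j :: l)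
  /-- `p_{i₀,…,i_{2r-1},m,i} < p_{i₀,…,i_{2r-1},k}` for `k ≤ m` -/
  | below (l : List ℕ) (i m k : ℕ) (hl : Even l.length) (h : k ≤ m) : Lt (i :: m :: l) (k :: l)
  /-- `p_{i₀,…,i_{2r},k} < p_{i₀,…,i_{2r},m,i}` for `k ≤ m` -/
  | above (l : List ℕ) (i m k : ℕ) (hl : Odd l.length) (h : k ≤ m) : Lt (k :: l) (i :: m :: l)

theorem Lt.irrefl {a b : List ℕ} (h : Lt a b) : a ≠ b := by
  intro e
  cases h with
  | root i => simp at e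
  | even_sibling l i j hl h => simp at e; omega
  | odd_sibling l i j hl h => simp at e; omega
  | below l i m k hl h => have := congrArg List.length e; simp at this
  | above l i m k hl h => have := congrArg List.length e; simp at this

theorem Lt.trans {a b c : List ℕ} (h : Lt a b) (h' : Lt b c) : Lt a c := by
  cases h <;> cases h' <;>
    first
    | (exfalso; simp_all only [List.length_cons, List.length_nil, Nat.even_iff, Nat.odd_iff]; omega)
    | exact Lt.root _
    | exact Lt.even_sibling _ _ _ (by assumption) (by omega)
    | exact Lt.odd_sibling _ _ _ (by assumption) (by omega)
    | exact Lt.below _ _ _ _ (by assumption) (by omega)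
    | exact Lt.above _ _ _ _ (by assumption) (by omega)

/-- The poset `P`. -/
instance instPartialOrder : PartialOrder TreePoint where
  le a b := a = b ∨ Lt a.index b.index
  le_refl a := Or.inl rfl
  le_trans a b c := by
    rintro (rfl | h) (rfl | h')
    · exact Or.inl rfl
    · exact Or.inr h'
    · exact Or.inr h
    · exact Or.inr (h.trans h')
  le_antisymm a b := by
    rintro (rfl | h) (h' | h')
    · rfl
    · rfl
    · exact h'.symm
    · exact absurd rfl (h.trans h').irrefl

end TreePoint

/-! Everything goes through Priestley duality: a poset is representable exactly when it carries a
Priestley topology (`representable_iff_exists_isPriestleyTopology`). For 1, Priestley topologies on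
the components are glued: each neighbourhood of one chosen point swallows all but finitely many
components. This makes the union compact without adding a point, and the separating clopen sets
survive. For 2, principal ideals and filters are closed in a Priestley space, so a family of them
with the finite intersection property has a common point; that point is comparable to a member of
the component, hence lies in it.

For 3, the cut space is compact, has no isolated points, and its points are separated by countably
many clopen sets. It therefore has a tree of clopen cells (`nonempty_cellScheme`): each cell loses
one distinguished point, and the rest splits into infinitely many child cells. Ordering the
distinguished points like `TreePoint` and leaving every other point comparable only to itself makes
the distinguished points one order component. Finite unions of initial sibling cells are increasing
below nodes of even length and decreasing below nodes of odd length, and they suffice for Priestley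
separation (`CellScheme.exists_initialCells_of_not_le`).

By itself the component has no Priestley topology. Such a topology would be compact Hausdorff on a
countable set, so by Baire some point would be isolated; but each point is the infimum or the
supremum of the sequence of its children, which rules this out. -/

/-! ### Priestley duality for posets -/

section PriestleyDuality

open Set Order

/-- The lattice of clopen increasing sets is distributive. -/
@[reducible]
def ClopenUpperSet.distribLattice (X : Type*) [TopologicalSpace X] [LE X] :
    DistribLattice (ClopenUpperSet X) :=
  { (inferInstance : Lattice (ClopenUpperSet X)) with
    le_sup_inf := fun a b c => by
      change ((a ⊔ b) ⊓ (a ⊔ c) : ClopenUpperSet X) ≤ a ⊔ b ⊓ c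
      rw [← SetLike.coe_subset_coe]
      simp [Set.union_inter_distrib_left] }

/-- The prime filter of a point, as an ideal of the dual lattice. -/
def pointIdeal {X : Type*} [TopologicalSpace X] [Preorder X] (x : X) :
    Ideal (ClopenUpperSet X)ᵒᵈ where
  carrier := {U | x ∈ (OrderDual.ofDual U : ClopenUpperSet X)}
  lower' := fun U V h hU =>
    SetLike.coe_subset_coe.2
      (show (OrderDual.ofDual U : ClopenUpperSet X) ≤ OrderDual.ofDual V from h) hU
  nonempty' := ⟨OrderDual.toDual ⊤, by
    change x ∈ (⊤ : ClopenUpperSet X)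
    rw [← SetLike.mem_coe, ClopenUpperSet.coe_top]; trivial⟩
  directed' := fun U hU V hV => ⟨U ⊔ V, by
    change x ∈ ((OrderDual.ofDual U ⊓ OrderDual.ofDual V : ClopenUpperSet X) : Set X)
    rw [ClopenUpperSet.coe_inf]; exact ⟨hU, hV⟩, le_sup_left, le_sup_right⟩

theorem mem_pointIdeal {X : Type*} [TopologicalSpace X] [Preorder X] {x : X}
    {U : (ClopenUpperSet X)ᵒᵈ} :
    U ∈ pointIdeal x ↔ x ∈ ((OrderDual.ofDual U : ClopenUpperSet X) : Set X) :=
  Iff.rfl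

theorem pointIdeal_isPrime {X : Type*} [TopologicalSpace X] [Preorder X] (x : X) :
    (pointIdeal x).IsPrime := by
  have : (pointIdeal x).IsProper := by
    apply Ideal.isProper_of_notMem (p := OrderDual.toDual ⊥)
    rw [mem_pointIdeal]
    simp
  refine Ideal.IsPrime.of_mem_or_mem ?_
  intro U V h
  rw [mem_pointIdeal] at h
  change x ∈ ((OrderDual.ofDual U ⊔ OrderDual.ofDual V : ClopenUpperSet X) : Set X) at h
  rw [ClopenUpperSet.coe_sup] at h
  exact h

theorem pointIdeal_le_iff {X : Type*} [TopologicalSpace X] [Preorder X] [PriestleySpace X]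
    {x y : X} : pointIdeal x ≤ pointIdeal y ↔ x ≤ y := by
  constructor
  · intro h
    by_contra hxy
    obtain ⟨U, hU, hU', hx, hy⟩ := exists_isClopen_upper_of_not_le hxy
    exact hy (@h (OrderDual.toDual (⟨⟨U, hU⟩, hU'⟩ : ClopenUpperSet X)) hx)
  · intro h U hU
    exact (OrderDual.ofDual U).upper h hU

/-- Compactness yields the point: it must lie in every clopen set belonging to `I` and outside every
other one, and finitely many of these conditions are always compatible. -/
theorem exists_pointIdeal_eq {X : Type*} [TopologicalSpace X] [Preorder X] [CompactSpace X]
    (I : Ideal (ClopenUpperSet X)ᵒᵈ) (hI : I.IsPrime) : ∃ x : X, pointIdeal x = I := by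
  classical
  let c : (ClopenUpperSet X)ᵒᵈ → Set X := fun U => ((OrderDual.ofDual U : ClopenUpperSet X) : Set X)
  let Z : (ClopenUpperSet X)ᵒᵈ → Set X := fun U => if U ∈ I then c U else (c U)ᶜ
  have hc : ∀ U, IsClopen (c U) := fun U => (OrderDual.ofDual U).isClopen
  have hZ : ∀ U, IsClosed (Z U) := by
    intro U
    by_cases h : U ∈ I
    · simpa [Z, h] using (hc U).isClosed
    · simpa [Z, h] using (hc U).isOpen
  -- Closure under joins merges the conditions from members of `I` into one `A`; primality merges
  -- the others into one `B`. An empty `c A ∩ (c B)ᶜ` would then force `B ∈ I`.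
  have key : ∀ s : Finset (ClopenUpperSet X)ᵒᵈ, ∃ A ∈ I, ∃ B ∉ I, c A ∩ (c B)ᶜ ⊆ ⋂ U ∈ s, Z U := by
    intro s
    induction s using Finset.induction_on with
    | empty =>
      have htop : (OrderDual.toDual ⊥ : (ClopenUpperSet X)ᵒᵈ) ∉ I := by
        intro h
        have : I.IsProper := hI.toIsProper
        exact Ideal.IsProper.top_notMem this h
      exact ⟨OrderDual.toDual ⊤, I.bot_mem, _, htop, by simp⟩
    | insert U s hU ih =>
      obtain ⟨A, hA, B, hB, h⟩ := ih
      rw [Finset.set_biInter_insert]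
      by_cases hUI : U ∈ I
      · refine ⟨U ⊔ A, Ideal.sup_mem hUI hA, B, hB, ?_⟩
        have : c (U ⊔ A) = c U ∩ c A := ClopenUpperSet.coe_inf _ _
        rw [this]
        simp only [Z, hUI, if_true]
        exact fun x hx => ⟨hx.1.1, h ⟨hx.1.2, hx.2⟩⟩
      · refine ⟨A, hA, U ⊓ B, fun hm => (hI.mem_or_mem hm).elim hUI hB, ?_⟩
        have : c (U ⊓ B) = c U ∪ c B := ClopenUpperSet.coe_sup _ _
        rw [this]
        simp only [Z, hUI, if_false]
        exact fun x hx => ⟨fun hxU => hx.2 (Or.inl hxU), h ⟨hx.1, fun hxB => hx.2 (Or.inr hxB)⟩⟩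
  have hne : (⋂ U, Z U).Nonempty := by
    by_contra hemp
    rw [not_nonempty_iff_eq_empty] at hemp
    obtain ⟨s, hs⟩ := isCompact_univ.elim_finite_subfamily_closed Z hZ (by rw [hemp, inter_empty])
    rw [univ_inter] at hs
    obtain ⟨A, hA, B, hB, h⟩ := key s
    rw [hs] at h
    refine hB (I.lower (show B ≤ A from ?_) hA)
    change c A ⊆ c B
    intro x hx
    by_contra hxB
    exact h ⟨hx, hxB⟩
  obtain ⟨x, hx⟩ := hne
  refine ⟨x, SetLike.ext fun U => ?_⟩
  have hxU := mem_iInter.1 hx U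
  rw [mem_pointIdeal]
  by_cases h : U ∈ I
  · simp only [Z, h, if_true] at hxU
    exact ⟨fun _ => h, fun _ => hxU⟩
  · simp only [Z, h, if_false] at hxU
    exact ⟨fun h' => absurd h' hxU, fun h' => absurd h' h⟩

theorem IsPriestleyTopology.representable {X : Type u} [PartialOrder X] {τ : TopologicalSpace X}
    (h : IsPriestleyTopology τ) : Representable X := by
  obtain ⟨hc, hp⟩ := h
  let _ := ClopenUpperSet.distribLattice X
  -- The increasing sets through `x` form a filter that grows with `x`; dualizing turns it into an
  -- ideal without reversing inclusion.
  refine ⟨(ClopenUpperSet X)ᵒᵈ, inferInstance, inferInstance, ⟨?_⟩⟩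
  let f : X ↪o {I : Ideal (ClopenUpperSet X)ᵒᵈ // I.IsPrime} :=
    OrderEmbedding.ofMapLEIff (fun x => ⟨pointIdeal x, pointIdeal_isPrime x⟩)
      fun _ _ => pointIdeal_le_iff
  refine OrderIso.ofSurjective f fun I => ?_
  obtain ⟨x, hx⟩ := exists_pointIdeal_eq I.1 I.2
  exact ⟨x, Subtype.ext hx⟩

theorem Representable.exists_isPriestleyTopology {X : Type u} [PartialOrder X]
    (h : Representable X) : ∃ τ : TopologicalSpace X, IsPriestleyTopology τ := by
  classical
  obtain ⟨L, _, _, ⟨e⟩⟩ := h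
  let f : X → L → Bool := fun x a => decide (a ∈ (e x).1)
  have hf : ∀ x a, f x a = true ↔ a ∈ (e x).1 := fun x a => by simp [f]
  let τ : TopologicalSpace X := TopologicalSpace.induced f inferInstance
  have hind : Topology.IsInducing f := ⟨rfl⟩
  -- Being a prime ideal is expressed by equations between finitely many coordinates each, so the
  -- image in the compact space `L → Bool` is closed.
  have hrange : range f = {g : L → Bool | g ⊥ = true ∧ g ⊤ = false ∧
      (∀ a b, g (a ⊔ b) = (g a && g b)) ∧ ∀ a b, g (a ⊓ b) = (g a || g b)} := by
    ext g
    constructor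
    · rintro ⟨x, rfl⟩
      have hI := (e x).2
      have := hI.toIsProper
      refine ⟨(hf x ⊥).2 (Ideal.bot_mem _), ?_, fun a b => ?_, fun a b => ?_⟩
      · rw [← Bool.not_eq_true, hf]
        exact Ideal.IsProper.top_notMem this
      · rw [Bool.eq_iff_iff, Bool.and_eq_true, hf, hf, hf, Ideal.sup_mem_iff]
      · rw [Bool.eq_iff_iff, Bool.or_eq_true, hf, hf, hf]
        exact ⟨hI.mem_or_mem, fun h => h.elim (Ideal.lower _ inf_le_left)
          (Ideal.lower _ inf_le_right)⟩
    · rintro ⟨h0, h1, hsup, hinf⟩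
      let I : Ideal L :=
        { carrier := {a | g a = true}
          lower' := fun a b hba ha => by
            have := hsup a b
            rw [sup_eq_left.2 hba, show g a = true from ha, Bool.true_and] at this
            exact this.symm
          nonempty' := ⟨⊥, h0⟩
          directed' := fun a ha b hb => ⟨a ⊔ b, (hsup a b).trans (by
            rw [show g a = true from ha, show g b = true from hb]; rfl), le_sup_left, le_sup_right⟩ }
      have hmem : ∀ a, a ∈ I ↔ g a = true := fun a => Iff.rfl
      have : I.IsProper := Ideal.isProper_of_notMem (p := ⊤) (by simp [hmem, h1])
      have hI : I.IsPrime := Ideal.IsPrime.of_mem_or_mem (by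
        intro a b
        simp [hmem, hinf])
      refine ⟨e.symm ⟨I, hI⟩, ?_⟩
      funext a
      rw [Bool.eq_iff_iff, hf, OrderIso.apply_symm_apply, hmem]
  have hclosed : IsClosed (range f) := by
    rw [hrange]
    refine IsClosed.inter (isClosed_eq (by fun_prop) (by fun_prop)) (IsClosed.inter
      (isClosed_eq (by fun_prop) (by fun_prop)) (IsClosed.inter ?_ ?_))
    · change IsClosed {g : L → Bool | ∀ a b, g (a ⊔ b) = (g a && g b)}
      simp only [ofPred_forall]
      refine isClosed_iInter fun a => isClosed_iInter fun b => isClosed_eq (by fun_prop) ?_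
      have h : Continuous fun q : Bool × Bool => (q.1 && q.2) := continuous_of_discreteTopology
      have h' : Continuous fun g : L → Bool => (g a, g b) := by fun_prop
      exact h.comp h'
    · change IsClosed {g : L → Bool | ∀ a b, g (a ⊓ b) = (g a || g b)}
      simp only [ofPred_forall]
      refine isClosed_iInter fun a => isClosed_iInter fun b => isClosed_eq (by fun_prop) ?_
      have h : Continuous fun q : Bool × Bool => (q.1 || q.2) := continuous_of_discreteTopology
      have h' : Continuous fun g : L → Bool => (g a, g b) := by fun_prop
      exact h.comp h'
  refine ⟨τ, ⟨?_⟩, ⟨?_⟩⟩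
  · rw [hind.isCompact_iff, image_univ]
    exact hclosed.isCompact
  · intro x y hxy
    rw [← e.le_iff_le] at hxy
    obtain ⟨a, hax, hay⟩ := Set.not_subset.1 (show ¬ ((e x).1 : Set L) ⊆ (e y).1 from hxy)
    refine ⟨{z | f z a = true}, ?_, ?_, (hf x a).2 hax, fun h => hay ((hf y a).1 h)⟩
    · exact (isClopen_discrete {true}).preimage ((continuous_apply a).comp hind.continuous)
    · intro z w hzw hz
      exact (hf w a).2 ((e.monotone hzw : (e z).1 ≤ (e w).1) ((hf z a).1 hz))

theorem representable_iff_exists_isPriestleyTopology {X : Type u} [PartialOrder X] :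
    Representable X ↔ ∃ τ : TopologicalSpace X, IsPriestleyTopology τ :=
  ⟨Representable.exists_isPriestleyTopology, fun ⟨_, h⟩ => h.representable⟩

theorem IsPriestleyTopology.induced {X Y : Type*} [PartialOrder X] [PartialOrder Y]
    {τ : TopologicalSpace Y} (h : IsPriestleyTopology τ) (e : X ≃o Y) :
    IsPriestleyTopology (τ.induced e) := by
  obtain ⟨hc, hp⟩ := h
  let _ := τ.induced e
  have hind : Topology.IsInducing e := ⟨rfl⟩
  refine ⟨⟨?_⟩, ⟨fun {x y} hxy => ?_⟩⟩
  · rw [hind.isCompact_iff, image_univ, e.surjective.range_eq]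
    exact isCompact_univ
  · obtain ⟨U, hU, hU', hx, hy⟩ := hp.priestley (fun h => hxy (e.le_iff_le.1 h))
    exact ⟨e ⁻¹' U, hU.preimage hind.continuous, hU'.preimage e.monotone, hx, hy⟩

end PriestleyDuality

/-! ### Decomposition into order components -/

section OrderComponents

open Set

theorem mem_orderComponent_self {X : Type*} [PartialOrder X] (x : X) : x ∈ orderComponent x :=
  Relation.TransGen.single (Or.inl le_rfl)

theorem mem_orderComponent_symm {X : Type*} [PartialOrder X] {x y : X}
    (h : y ∈ orderComponent x) : x ∈ orderComponent y := by
  change Relation.TransGen _ _ _ at h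
  change Relation.TransGen _ _ _
  induction h with
  | single h => exact Relation.TransGen.single h.symm
  | tail _ h ih => exact Relation.TransGen.head h.symm ih

theorem mem_orderComponent_trans {X : Type*} [PartialOrder X] {x y z : X}
    (h : y ∈ orderComponent x) (h' : z ∈ orderComponent y) : z ∈ orderComponent x :=
  Relation.TransGen.trans h h'

theorem mem_orderComponent_of_le {X : Type*} [PartialOrder X] {x y z : X}
    (h : y ∈ orderComponent x) (h' : y ≤ z) : z ∈ orderComponent x :=
  Relation.TransGen.tail h (Or.inl h')

theorem mem_orderComponent_of_ge {X : Type*} [PartialOrder X] {x y z : X}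
    (h : y ∈ orderComponent x) (h' : z ≤ y) : z ∈ orderComponent x :=
  Relation.TransGen.tail h (Or.inr h')

/-- The equivalence relation of lying in the same order component. -/
def orderComponentSetoid (X : Type*) [PartialOrder X] : Setoid X where
  r x y := y ∈ orderComponent x
  iseqv := ⟨mem_orderComponent_self, mem_orderComponent_symm, mem_orderComponent_trans⟩

/-- A poset is the disjoint union of its order components. -/
theorem nonempty_orderIso_sigma_orderComponent (X : Type*) [PartialOrder X] :
    Nonempty (X ≃o Σ q : Quotient (orderComponentSetoid X), orderComponent q.out) := by
  let q : X → Quotient (orderComponentSetoid X) := Quotient.mk _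
  have hq : ∀ x, x ∈ orderComponent (q x).out := fun x =>
    Quotient.mk_out (s := orderComponentSetoid X) x
  have hmk : ∀ (i : Quotient (orderComponentSetoid X)) (y : X),
      y ∈ orderComponent i.out → q y = i := by
    intro i y hy
    rw [← Quotient.out_eq i]
    exact (Quotient.sound (s := orderComponentSetoid X) hy).symm
  let f : (Σ i : Quotient (orderComponentSetoid X), orderComponent i.out) ↪o X :=
    OrderEmbedding.ofMapLEIff (fun z => z.2.1) (by
      rintro ⟨i, a, ha⟩ ⟨j, b, hb⟩
      constructor
      · intro h
        have hij : i = j := by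
          rw [← hmk i a ha, ← hmk j b hb]
          exact Quotient.sound (s := orderComponentSetoid X)
            (mem_orderComponent_of_le (mem_orderComponent_self a) h)
        subst hij
        exact Sigma.LE.fiber _ _ _ h
      · rintro ⟨⟩
        assumption)
  exact ⟨(OrderIso.ofSurjective f fun x => ⟨⟨q x, x, hq x⟩, rfl⟩).symm⟩

end OrderComponents

/-! ### Gluing Priestley spaces at a point -/

section DisjointUnion

open Set

variable {ι : Type*} {K : ι → Type*}

theorem isUpperSet_sigma_image [∀ i, PartialOrder (K i)] {i : ι} {V : Set (K i)} (hV : IsUpperSet V) :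
    IsUpperSet (Sigma.mk i '' V) := by
  rintro _ _ ⟨⟩ ⟨a, ha, h⟩
  rename_i j b c hbc
  cases h
  exact ⟨c, hV hbc ha, rfl⟩

theorem isLowerSet_sigma_image [∀ i, PartialOrder (K i)] {i : ι} {V : Set (K i)} (hV : IsLowerSet V) :
    IsLowerSet (Sigma.mk i '' V) := by
  rintro _ _ ⟨⟩ ⟨a, ha, h⟩
  rename_i j b c hbc
  cases h
  exact ⟨b, hV hbc ha, rfl⟩

variable [∀ i, TopologicalSpace (K i)]

/-- The topology on a disjoint union in which all summands but that of `p` are clopen, and every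
neighbourhood of `p` contains all but finitely many summands. -/
@[reducible]
def gluedTopology (p : Σ i, K i) : TopologicalSpace (Σ i, K i) where
  IsOpen U := (∀ i, IsOpen (Sigma.mk i ⁻¹' U)) ∧ (p ∈ U → {i | Sigma.mk i ⁻¹' U ≠ univ}.Finite)
  isOpen_univ := ⟨fun i => isOpen_univ, fun _ => by simp⟩
  isOpen_inter U V hU hV := by
    refine ⟨fun i => (hU.1 i).inter (hV.1 i), fun hp => ?_⟩
    refine ((hU.2 hp.1).union (hV.2 hp.2)).subset fun i hi => ?_
    by_contra h
    simp only [mem_union, mem_ofPred_eq, not_or, not_not] at h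
    exact hi (by rw [preimage_inter, h.1, h.2, inter_univ])
  isOpen_sUnion S hS := by
    refine ⟨fun i => ?_, ?_⟩
    · rw [preimage_sUnion]
      exact isOpen_biUnion fun U hU => (hS U hU).1 i
    · rintro ⟨U, hU, hp⟩
      refine ((hS U hU).2 hp).subset fun i hi h => hi ?_
      rw [eq_univ_iff_forall] at h ⊢
      exact fun a => ⟨U, hU, h a⟩

theorem isClopen_glued_image {p : Σ i, K i} {i : ι} {V : Set (K i)} (hV : IsClopen V)
    (hp : p ∉ Sigma.mk i '' V) : @IsClopen _ (gluedTopology p) (Sigma.mk i '' V) := by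
  have hpre : Sigma.mk i ⁻¹' (Sigma.mk i '' V) = V := preimage_image_eq _ sigma_mk_injective
  have hpre' : ∀ j, j ≠ i → Sigma.mk j ⁻¹' (Sigma.mk i '' V) = ∅ := by
    intro j hj
    ext a
    simp only [mem_preimage, mem_image, Sigma.mk.injEq, mem_empty_iff_false, iff_false]
    rintro ⟨b, _, rfl, _⟩
    exact hj rfl
  let _ := gluedTopology p
  refine ⟨⟨⟨fun j => ?_, fun _ => ?_⟩⟩, fun j => ?_, fun h => absurd h hp⟩
  · rw [preimage_compl]
    obtain rfl | hj := eq_or_ne j i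
    · rw [hpre]; exact hV.compl.isOpen
    · rw [hpre' j hj, compl_empty]; exact isOpen_univ
  · refine (finite_singleton i).subset fun j hj => ?_
    by_contra hji
    exact hj (by rw [preimage_compl, hpre' j hji, compl_empty])
  · obtain rfl | hj := eq_or_ne j i
    · rw [hpre]; exact hV.isOpen
    · rw [hpre' j hj]; exact isOpen_empty

theorem compactSpace_gluedTopology (p : Σ i, K i) [∀ i, CompactSpace (K i)] :
    @CompactSpace _ (gluedTopology p) := by
  let _ := gluedTopology p
  refine ⟨isCompact_of_finite_subcover fun {κ} U hU hcov => ?_⟩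
  obtain ⟨k, hk⟩ := mem_iUnion.1 (hcov (mem_univ p))
  have hfin := (hU k).2 hk
  have hcont : ∀ i, Continuous (Sigma.mk i : K i → Σ i, K i) :=
    fun i => ⟨fun V hV => hV.1 i⟩
  -- A member of the cover that contains `p` leaves only finitely many compact summands to be
  -- covered.
  have hcomp : IsCompact (⋃ i ∈ {i | Sigma.mk i ⁻¹' U k ≠ univ}, range (Sigma.mk i : K i → _)) :=
    hfin.isCompact_biUnion fun i _ => isCompact_range (hcont i)
  obtain ⟨t, ht⟩ := hcomp.elim_finite_subcover U hU ((subset_univ _).trans hcov)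
  classical
  refine ⟨insert k t, fun z _ => ?_⟩
  rw [Finset.set_biUnion_insert]
  obtain ⟨i, a⟩ := z
  by_cases h : Sigma.mk i ⁻¹' U k = univ
  · exact Or.inl (eq_univ_iff_forall.1 h a)
  · exact Or.inr (ht (mem_biUnion (x := i) h ⟨a, rfl⟩))

variable [∀ i, PartialOrder (K i)]

theorem isPriestleyTopology_gluedTopology (p : Σ i, K i)
    (h : ∀ i, IsPriestleyTopology (inferInstance : TopologicalSpace (K i))) :
    IsPriestleyTopology (gluedTopology p) := by
  have hc : ∀ i, CompactSpace (K i) := fun i => (h i).1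
  have hp : ∀ i, PriestleySpace (K i) := fun i => (h i).2
  refine ⟨compactSpace_gluedTopology p, ?_⟩
  let _ := gluedTopology p
  refine ⟨?_⟩
  rintro ⟨i, a⟩ ⟨j, b⟩ hab
  obtain rfl | hij := eq_or_ne i j
  · have hab' : ¬ a ≤ b := fun h => hab (Sigma.LE.fiber _ _ _ h)
    obtain ⟨V, hV, hV', ha, hb⟩ := exists_isClopen_upper_of_not_le hab'
    -- The images of `V` and `Vᶜ` are not both neighbourhoods to worry about: at least one misses
    -- `p`, hence is clopen. In the first case the complement of the image of `Vᶜ` is used.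
    by_cases hpV : p ∈ Sigma.mk i '' V
    · refine ⟨(Sigma.mk i '' Vᶜ)ᶜ, (isClopen_glued_image hV.compl ?_).compl,
        (isLowerSet_sigma_image hV'.compl).compl, ?_, not_not.2 ⟨b, hb, rfl⟩⟩
      · rintro ⟨c, hc, rfl⟩
        obtain ⟨d, hd, hdc⟩ := hpV
        cases hdc
        exact hc hd
      · rintro ⟨c, hc, hca⟩
        cases hca
        exact hc ha
    · refine ⟨_, isClopen_glued_image hV hpV, isUpperSet_sigma_image hV', ⟨a, ha, rfl⟩, ?_⟩
      rintro ⟨c, hc, hcb⟩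
      cases hcb
      exact hb hc
  · by_cases hi : i = p.1
    · refine ⟨(Sigma.mk j '' univ)ᶜ, (isClopen_glued_image isClopen_univ ?_).compl,
        (isLowerSet_sigma_image isLowerSet_univ).compl, ?_, not_not.2 ⟨b, trivial, rfl⟩⟩
      · rintro ⟨c, -, rfl⟩
        exact hij hi
      · rintro ⟨c, -, hca⟩
        exact hij (congrArg Sigma.fst hca).symm
    · refine ⟨_, isClopen_glued_image isClopen_univ ?_, isUpperSet_sigma_image isUpperSet_univ,
        ⟨a, trivial, rfl⟩, ?_⟩
      · rintro ⟨c, -, rfl⟩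
        exact hi rfl
      · rintro ⟨c, -, hcb⟩
        exact hij (congrArg Sigma.fst hcb)

end DisjointUnion

/-! ### Proofs of the first two assertions -/

section

open Set

theorem representable_of_forall_orderComponent {X : Type u} [PartialOrder X]
    (h : ∀ x : X, Representable (orderComponent x)) : Representable X := by
  choose τ hτ using fun x => (h x).exists_isPriestleyTopology
  rw [representable_iff_exists_isPriestleyTopology]
  obtain hX | ⟨⟨x⟩⟩ := isEmpty_or_nonempty X
  · let _ : TopologicalSpace X := ⊥
    exact ⟨_, inferInstance, ⟨fun {x} => isEmptyElim x⟩⟩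
  · obtain ⟨e⟩ := nonempty_orderIso_sigma_orderComponent X
    let _ : ∀ q : Quotient (orderComponentSetoid X), TopologicalSpace (orderComponent q.out) :=
      fun q => τ q.out
    exact ⟨_, (isPriestleyTopology_gluedTopology (e x) fun q => hτ q.out).induced e⟩

theorem PriestleySpace.isClosed_Ici {X : Type*} [TopologicalSpace X] [Preorder X]
    [PriestleySpace X] (a : X) : IsClosed (Ici a) := by
  rw [← isOpen_compl_iff, isOpen_iff_forall_mem_open]
  intro y hy
  obtain ⟨U, hU, hU', ha, hyU⟩ := exists_isClopen_upper_of_not_le (show ¬ a ≤ y from hy)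
  exact ⟨Uᶜ, fun z hz haz => hz (hU' haz ha), hU.compl.isOpen, hyU⟩

theorem PriestleySpace.isClosed_Iic {X : Type*} [TopologicalSpace X] [Preorder X]
    [PriestleySpace X] (a : X) : IsClosed (Iic a) := by
  rw [← isOpen_compl_iff, isOpen_iff_forall_mem_open]
  intro y hy
  obtain ⟨U, hU, hU', hyU, ha⟩ := exists_isClopen_upper_of_not_le (show ¬ y ≤ a from hy)
  exact ⟨U, fun z hz hza => ha (hU' hza hz), hU.isOpen, hyU⟩

/-- The interval topology is compact if every family of principal ideals and principal filters
with the finite intersection property has a common point. -/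
theorem compactSpace_intervalTopology {X : Type*} [PartialOrder X]
    (h : ∀ A B : Set X, (∀ F ⊆ A, ∀ G ⊆ B, F.Finite → G.Finite →
        ∃ z, (∀ a ∈ F, z ≤ a) ∧ ∀ b ∈ G, b ≤ z) → ∃ z, (∀ a ∈ A, z ≤ a) ∧ ∀ b ∈ B, b ≤ z) :
    @CompactSpace X (intervalTopology X) := by
  refine @compactSpace_generateFrom X (intervalTopology X) _ rfl fun P hP hcov => ?_
  by_contra! hno
  obtain ⟨z, hA, hB⟩ := h {a | (Iic a)ᶜ ∈ P} {b | (Ici b)ᶜ ∈ P} (by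
    intro F hF G hG hFf hGf
    have hne := hno ((fun a => (Iic a)ᶜ) '' F ∪ (fun b => (Ici b)ᶜ) '' G)
      (union_subset (image_subset_iff.2 hF) (image_subset_iff.2 hG))
      ((hFf.image _).union (hGf.image _))
    obtain ⟨z, hz⟩ := (ne_univ_iff_exists_notMem _).1 hne
    refine ⟨z, fun a ha => ?_, fun b hb => ?_⟩
    · by_contra hza
      exact hz ⟨_, Or.inl ⟨a, ha, rfl⟩, hza⟩
    · by_contra hza
      exact hz ⟨_, Or.inr ⟨b, hb, rfl⟩, hza⟩)
  obtain ⟨S, hS, hz⟩ := (eq_univ_iff_forall.1 hcov) z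
  obtain ⟨a, rfl⟩ | ⟨b, rfl⟩ := hP hS
  · exact hz (hA a hS)
  · exact hz (hB b hS)

theorem compactSpace_intervalTopology_of_completeLattice (X : Type*) [CompleteLattice X] :
    @CompactSpace X (intervalTopology X) := by
  refine compactSpace_intervalTopology fun A B h => ⟨sSup B, fun a ha => sSup_le fun b hb => ?_,
    fun b hb => le_sSup hb⟩
  obtain ⟨z, hz, hz'⟩ := h {a} (singleton_subset_iff.2 ha) {b} (singleton_subset_iff.2 hb)
    (finite_singleton _) (finite_singleton _)
  exact (hz' b rfl).trans (hz a rfl)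

theorem Representable.compactSpace_orderComponent {X : Type u} [PartialOrder X]
    (h : Representable X) (x : X) :
    @CompactSpace (orderComponent x) (intervalTopology (orderComponent x)) := by
  obtain ⟨τ, hc, hp⟩ := h.exists_isPriestleyTopology
  refine compactSpace_intervalTopology fun A B hAB => ?_
  let Z : A ⊕ B → Set X := Sum.elim (fun a => Iic a.1.1) (fun b => Ici b.1.1)
  have hZ : ∀ s, IsClosed (Z s) := by
    rintro (a | b)
    · exact PriestleySpace.isClosed_Iic _
    · exact PriestleySpace.isClosed_Ici _
  have hne : (univ ∩ ⋂ s, Z s).Nonempty := by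
    refine isCompact_univ.inter_iInter_nonempty Z hZ fun t => ?_
    obtain ⟨z, hz, hz'⟩ := hAB ((fun a : A => a.1) '' {a | Sum.inl a ∈ t})
      (by rintro _ ⟨a, _, rfl⟩; exact a.2) ((fun b : B => b.1) '' {b | Sum.inr b ∈ t})
      (by rintro _ ⟨a, _, rfl⟩; exact a.2)
      ((t.finite_toSet.preimage Sum.inl_injective.injOn).image _)
      ((t.finite_toSet.preimage Sum.inr_injective.injOn).image _)
    refine ⟨z, trivial, mem_iInter₂.2 ?_⟩
    rintro (a | b) hs
    · exact hz _ ⟨a, hs, rfl⟩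
    · exact hz' _ ⟨b, hs, rfl⟩
  obtain ⟨z, -, hz⟩ := hne
  rw [mem_iInter] at hz
  -- The common point `z` is only known to lie in `X`; any one member of either family is comparable
  -- to it and puts it in the component. Without members, `x` itself serves.
  obtain hA | ⟨a, ha⟩ := A.eq_empty_or_nonempty
  · obtain hB | ⟨b, hb⟩ := B.eq_empty_or_nonempty
    · exact ⟨⟨x, mem_orderComponent_self x⟩, by simp [hA], by simp [hB]⟩
    · exact ⟨⟨z, mem_orderComponent_of_le b.2 (hz (Sum.inr ⟨b, hb⟩))⟩,
        fun a ha => hz (Sum.inl ⟨a, ha⟩), fun b hb => hz (Sum.inr ⟨b, hb⟩)⟩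
  · exact ⟨⟨z, mem_orderComponent_of_ge a.2 (hz (Sum.inl ⟨a, ha⟩))⟩,
      fun a ha => hz (Sum.inl ⟨a, ha⟩), fun b hb => hz (Sum.inr ⟨b, hb⟩)⟩

end

/-! ### Cell schemes and the order they induce -/

section CellSchemes

open Set

/-- A tree of clopen cells with a distinguished point in every cell, such that the children of a
cell partition the complement of its distinguished point, and the cells separate the points. -/
structure CellScheme (X : Type*) [TopologicalSpace X] where
  cell : List ℕ → Set X
  pt : List ℕ → X
  isClopen_cell : ∀ s, IsClopen (cell s)
  cell_nil : cell [] = univ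
  pt_mem : ∀ s, pt s ∈ cell s
  cell_cons_subset : ∀ i s, cell (i :: s) ⊆ cell s
  pt_notMem : ∀ i s, pt s ∉ cell (i :: s)
  eq_of_mem : ∀ {i j s x}, x ∈ cell (i :: s) → x ∈ cell (j :: s) → i = j
  eq_pt_or_mem : ∀ {s x}, x ∈ cell s → x = pt s ∨ ∃ i, x ∈ cell (i :: s)
  separates : ∀ {x y}, x ≠ y → ∃ n, ∀ s, s.length = n → x ∈ cell s → y ∉ cell s

namespace CellScheme

variable {X : Type*} [TopologicalSpace X] (S : CellScheme X)

theorem cell_subset_of_suffix {s t : List ℕ} (h : s <:+ t) : S.cell t ⊆ S.cell s := by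
  obtain ⟨u, rfl⟩ := h
  induction u with
  | nil => exact subset_rfl
  | cons i u ih => exact (S.cell_cons_subset i (u ++ s)).trans ih

theorem exists_cons_suffix {s t : List ℕ} (h : s <:+ t) (hne : s ≠ t) : ∃ i, i :: s <:+ t := by
  obtain ⟨u, rfl⟩ := h
  rcases List.eq_nil_or_concat u with rfl | ⟨u, i, rfl⟩
  · exact absurd rfl hne
  · exact ⟨i, u, by simp⟩

theorem suffix_or_suffix {s t : List ℕ} {x : X} (hs : x ∈ S.cell s) (ht : x ∈ S.cell t) :
    s <:+ t ∨ t <:+ s := by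
  induction s with
  | nil => exact Or.inl t.nil_suffix
  | cons i s ih =>
    obtain h | h := ih (S.cell_cons_subset i s hs)
    · by_cases hne : s = t
      · exact Or.inr (hne ▸ List.suffix_cons i s)
      · obtain ⟨j, hj⟩ := exists_cons_suffix h hne
        obtain rfl := S.eq_of_mem hs (S.cell_subset_of_suffix hj ht)
        exact Or.inl hj
    · exact Or.inr (h.trans (List.suffix_cons i s))

theorem pt_mem_cell_iff {s t : List ℕ} : S.pt s ∈ S.cell t ↔ t <:+ s := by
  refine ⟨fun h => ?_, fun h => S.cell_subset_of_suffix h (S.pt_mem s)⟩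
  obtain h' | h' := S.suffix_or_suffix h (S.pt_mem s)
  · exact h'
  · by_cases hne : s = t
    · exact hne ▸ List.suffix_rfl
    · obtain ⟨i, hi⟩ := exists_cons_suffix h' hne
      exact absurd (S.cell_subset_of_suffix hi h) (S.pt_notMem i s)

theorem pt_injective : Function.Injective S.pt := by
  intro s t h
  have h₁ : s <:+ t := S.pt_mem_cell_iff.1 (h ▸ S.pt_mem s)
  have h₂ : t <:+ s := S.pt_mem_cell_iff.1 (h ▸ S.pt_mem t)
  exact h₁.eq_of_length_le h₂.length_le

/-- Two distinct points are split at some node: either one of them is the distinguished point of a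
cell and the other one is in a child, or they are in different children. -/
theorem exists_split {x y : X} (hxy : x ≠ y) :
    ∃ s, (x = S.pt s ∧ ∃ j, y ∈ S.cell (j :: s)) ∨ (y = S.pt s ∧ ∃ i, x ∈ S.cell (i :: s)) ∨
      ∃ i j, i ≠ j ∧ x ∈ S.cell (i :: s) ∧ y ∈ S.cell (j :: s) := by
  classical
  have hex := S.separates hxy
  -- The root cell is the whole space, so the first separating level is positive, and one level
  -- earlier the points still share a cell.
  obtain ⟨m, hm⟩ : ∃ m, Nat.find hex = m + 1 := by
    refine Nat.exists_eq_succ_of_ne_zero fun h0 => ?_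
    have := Nat.find_spec hex
    rw [h0] at this
    exact this [] rfl (by simp [S.cell_nil]) (by simp [S.cell_nil])
  have hspec := Nat.find_spec hex
  rw [hm] at hspec
  have hmin := Nat.find_min hex (show m < Nat.find hex by omega)
  push Not at hmin
  obtain ⟨s, hs, hx, hy⟩ := hmin
  refine ⟨s, ?_⟩
  obtain rfl | ⟨i, hi⟩ := S.eq_pt_or_mem hx
  · obtain rfl | ⟨j, hj⟩ := S.eq_pt_or_mem hy
    · exact absurd rfl hxy
    · exact Or.inl ⟨rfl, j, hj⟩
  · obtain rfl | ⟨j, hj⟩ := S.eq_pt_or_mem hy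
    · exact Or.inr (Or.inl ⟨rfl, i, hi⟩)
    · refine Or.inr (Or.inr ⟨i, j, ?_, hi, hj⟩)
      rintro rfl
      exact hspec (i :: s) (by simp [hs]) hi hj

/-- The order of `TreePoint`, transported to the distinguished points. -/
@[reducible]
def partialOrder : PartialOrder X where
  le x y := x = y ∨ ∃ s t, x = S.pt s ∧ y = S.pt t ∧ TreePoint.Lt s t
  le_refl x := Or.inl rfl
  le_trans x y z := by
    rintro (rfl | ⟨s, t, rfl, rfl, h⟩) (rfl | ⟨t', u, ht, rfl, h'⟩)
    · exact Or.inl rfl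
    · exact Or.inr ⟨t', u, ht, rfl, h'⟩
    · exact Or.inr ⟨s, t, rfl, rfl, h⟩
    · obtain rfl := S.pt_injective ht
      exact Or.inr ⟨s, u, rfl, rfl, h.trans h'⟩
  le_antisymm x y := by
    rintro (rfl | ⟨s, t, rfl, rfl, h⟩) (h' | ⟨t', u, ht, hu, h'⟩)
    · rfl
    · rfl
    · exact h'.symm
    · obtain rfl := S.pt_injective ht
      obtain rfl := S.pt_injective hu
      exact absurd rfl (h.trans h').irrefl

/-- The union of a cell and its elder siblings. -/
def initialCells (k : ℕ) (l : List ℕ) : Set X := ⋃ i ∈ Iic k, S.cell (i :: l)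

theorem mem_initialCells {k : ℕ} {l : List ℕ} {x : X} :
    x ∈ S.initialCells k l ↔ ∃ i ≤ k, x ∈ S.cell (i :: l) := by
  simp [initialCells]

theorem isClopen_initialCells (k : ℕ) (l : List ℕ) : IsClopen (S.initialCells k l) :=
  (finite_Iic k).isClopen_biUnion fun _ _ => S.isClopen_cell _

theorem mem_initialCells_self {k : ℕ} {l : List ℕ} {x : X} (h : x ∈ S.cell (k :: l)) :
    x ∈ S.initialCells k l :=
  S.mem_initialCells.2 ⟨k, le_rfl, h⟩

theorem notMem_initialCells {k j : ℕ} {l : List ℕ} {x : X} (h : x ∈ S.cell (j :: l)) (hkj : k < j) :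
    x ∉ S.initialCells k l := by
  intro h'
  obtain ⟨i, hi, hx⟩ := S.mem_initialCells.1 h'
  have := S.eq_of_mem h hx
  omega

theorem pt_notMem_initialCells {k : ℕ} {l : List ℕ} : S.pt l ∉ S.initialCells k l := by
  intro h'
  obtain ⟨i, hi, hx⟩ := S.mem_initialCells.1 h'
  exact S.pt_notMem _ _ hx

theorem notMem_initialCells_of_notMem {k : ℕ} {l : List ℕ} {x : X} (h : x ∉ S.cell l) :
    x ∉ S.initialCells k l := by
  intro h'
  obtain ⟨i, hi, hx⟩ := S.mem_initialCells.1 h'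
  exact h (S.cell_cons_subset _ _ hx)

end CellScheme

/-- For even `l`, an upward relation can leave the subtree at `i :: l` only through `even_sibling`
or `below`, and both land on some `j :: l` with `j ≤ i`. This makes initial cells increasing. -/
theorem TreePoint.Lt.exists_suffix_of_even {s t l : List ℕ} {k i : ℕ} (h : TreePoint.Lt s t)
    (hl : Even l.length) (hi : i ≤ k) (hs : i :: l <:+ s) : ∃ j ≤ k, j :: l <:+ t := by
  cases h with
  | root a => simp at hs
  | even_sibling l' a b hl' hab =>
    rw [List.suffix_cons_iff] at hs
    obtain h | h := hs
    · cases h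
      exact ⟨b, by omega, List.suffix_rfl⟩
    · exact ⟨i, hi, h.trans (List.suffix_cons _ _)⟩
  | odd_sibling l' a b hl' hab =>
    rw [List.suffix_cons_iff] at hs
    obtain h | h := hs
    · cases h
      exact absurd hl (Nat.not_even_iff_odd.2 hl')
    · exact ⟨i, hi, h.trans (List.suffix_cons _ _)⟩
  | below l' a m b hl' hbm =>
    rw [List.suffix_cons_iff, List.suffix_cons_iff] at hs
    obtain h | h | h := hs
    · cases h
      exact absurd hl' (Nat.even_add_one.1 hl)
    · cases h
      exact ⟨b, by omega, List.suffix_rfl⟩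
    · exact ⟨i, hi, h.trans (List.suffix_cons _ _)⟩
  | above l' a m b hl' hbm =>
    rw [List.suffix_cons_iff] at hs
    obtain h | h := hs
    · cases h
      exact absurd hl (Nat.not_even_iff_odd.2 hl')
    · exact ⟨i, hi, h.trans ((List.suffix_cons _ _).trans (List.suffix_cons _ _))⟩

/-- The order dual of the even case: going down, the exits are `odd_sibling` and `above`. -/
theorem TreePoint.Lt.exists_suffix_of_odd {s t l : List ℕ} {k i : ℕ} (h : TreePoint.Lt s t)
    (hl : Odd l.length) (hi : i ≤ k) (ht : i :: l <:+ t) : ∃ j ≤ k, j :: l <:+ s := by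
  cases h with
  | root a =>
    rw [List.suffix_cons_iff] at ht
    obtain h | h := ht
    · cases h
      simp at hl
    · simp at h
  | even_sibling l' a b hl' hab =>
    rw [List.suffix_cons_iff] at ht
    obtain h | h := ht
    · cases h
      exact absurd hl (Nat.not_odd_iff_even.2 hl')
    · exact ⟨i, hi, h.trans (List.suffix_cons _ _)⟩
  | odd_sibling l' a b hl' hab =>
    rw [List.suffix_cons_iff] at ht
    obtain h | h := ht
    · cases h
      exact ⟨a, by omega, List.suffix_rfl⟩
    · exact ⟨i, hi, h.trans (List.suffix_cons _ _)⟩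
  | below l' a m b hl' hbm =>
    rw [List.suffix_cons_iff] at ht
    obtain h | h := ht
    · cases h
      exact absurd hl (Nat.not_odd_iff_even.2 hl')
    · exact ⟨i, hi, h.trans ((List.suffix_cons _ _).trans (List.suffix_cons _ _))⟩
  | above l' a m b hl' hbm =>
    rw [List.suffix_cons_iff, List.suffix_cons_iff] at ht
    obtain h | h | h := ht
    · cases h
      exact absurd hl' (Nat.odd_add_one.1 hl)
    · cases h
      exact ⟨b, by omega, List.suffix_rfl⟩
    · exact ⟨i, hi, h.trans (List.suffix_cons _ _)⟩

namespace CellScheme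

variable {X : Type*} [TopologicalSpace X] (S : CellScheme X)

theorem isUpperSet_initialCells {k : ℕ} {l : List ℕ} (hl : Even l.length) :
    letI := S.partialOrder
    IsUpperSet (S.initialCells k l) := by
  rintro x y (rfl | ⟨s, t, rfl, rfl, h⟩) hx
  · exact hx
  · obtain ⟨i, hi, hs⟩ := S.mem_initialCells.1 hx
    obtain ⟨j, hj, ht⟩ := h.exists_suffix_of_even hl hi (S.pt_mem_cell_iff.1 hs)
    exact S.mem_initialCells.2 ⟨j, hj, S.pt_mem_cell_iff.2 ht⟩

theorem isLowerSet_initialCells {k : ℕ} {l : List ℕ} (hl : Odd l.length) :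
    letI := S.partialOrder
    IsLowerSet (S.initialCells k l) := by
  rintro x y (rfl | ⟨s, t, rfl, rfl, h⟩) hx
  · exact hx
  · obtain ⟨i, hi, hs⟩ := S.mem_initialCells.1 hx
    obtain ⟨j, hj, ht⟩ := h.exists_suffix_of_odd hl hi (S.pt_mem_cell_iff.1 hs)
    exact S.mem_initialCells.2 ⟨j, hj, S.pt_mem_cell_iff.2 ht⟩

/-- A point that is not the distinguished point of its cell lies in a union of initial cells inside
this cell. -/
theorem exists_mem_initialCells {l : List ℕ} {x : X} (hx : x ∈ S.cell l) (hne : x ≠ S.pt l) :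
    ∃ k, x ∈ S.initialCells k l := by
  obtain h | ⟨k, hk⟩ := S.eq_pt_or_mem hx
  · exact absurd h hne
  · exact ⟨k, S.mem_initialCells_self hk⟩

/-- The node where `x` and `y` split either has suitable initial cells itself, or its parity is
wrong for the direction needed. In the latter case the relations of `P` show that one of the points
is not the distinguished point of its child cell (or grandchild cell), so initial cells one or two
levels deeper contain it and miss the other point. -/
theorem exists_initialCells_of_not_le {x y : X} (hxy : ¬ S.partialOrder.le x y) :
    ∃ k l, (Even l.length ∧ x ∈ S.initialCells k l ∧ y ∉ S.initialCells k l) ∨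
      (Odd l.length ∧ y ∈ S.initialCells k l ∧ x ∉ S.initialCells k l) := by
  have hne : x ≠ y := fun h => hxy (Or.inl h)
  have hlt : ∀ s t, TreePoint.Lt s t → x = S.pt s → y ≠ S.pt t :=
    fun s t h hx hy => hxy (Or.inr ⟨s, t, hx, hy, h⟩)
  obtain ⟨s, ⟨hxs, j, hj⟩ | ⟨hys, i, hi⟩ | ⟨i, j, hij, hi, hj⟩⟩ := S.exists_split hne <;>
    rcases Nat.even_or_odd s.length with hs | hs
  · have hy : y ≠ S.pt (j :: s) := by
      cases s with
      | nil => exact hlt _ _ (.root j) hxs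
      | cons m l =>
        exact hlt _ _ (.above l j m m (by simpa [Nat.even_add_one] using hs) le_rfl) hxs
    obtain ⟨k, hk⟩ := S.exists_mem_initialCells hj hy
    refine ⟨k, j :: s, Or.inr ⟨by simpa using hs.add_one, hk, ?_⟩⟩
    exact S.notMem_initialCells_of_notMem (hxs ▸ S.pt_notMem j s)
  · exact ⟨j, s, Or.inr ⟨hs, S.mem_initialCells_self hj, hxs ▸ S.pt_notMem_initialCells⟩⟩
  · exact ⟨i, s, Or.inl ⟨hs, S.mem_initialCells_self hi, hys ▸ S.pt_notMem_initialCells⟩⟩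
  · have hx : x ≠ S.pt (i :: s) := by
      cases s with
      | nil => simp at hs
      | cons m l =>
        exact fun h => hlt _ _ (.below l i m m (by simpa [Nat.odd_add_one] using hs) le_rfl) h hys
    obtain ⟨k, hk⟩ := S.exists_mem_initialCells hi hx
    refine ⟨k, i :: s, Or.inl ⟨by simpa using hs.add_one, hk, ?_⟩⟩
    exact S.notMem_initialCells_of_notMem (hys ▸ S.pt_notMem i s)
  · obtain hlt' | hgt := lt_or_gt_of_ne hij
    · exact ⟨i, s, Or.inl ⟨hs, S.mem_initialCells_self hi, S.notMem_initialCells hj hlt'⟩⟩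
    -- If `y` is distinguished in its child cell, then `x` can be neither `S.pt (i :: s)` nor one of
    -- the children of that point, since these lie below `y`; two levels down the parity is right
    -- again.
    by_cases hy : y = S.pt (j :: s)
    · have hx : x ≠ S.pt (i :: s) := fun h => hlt _ _ (.even_sibling s i j hs hgt) h hy
      obtain ⟨k, hk⟩ := S.eq_pt_or_mem hi |>.resolve_left hx
      have hx' : x ≠ S.pt (k :: i :: s) :=
        fun h => hlt _ _ (.below s k i j hs hgt.le) h hy
      obtain ⟨n, hn⟩ := S.exists_mem_initialCells hk hx'
      refine ⟨n, k :: i :: s, Or.inl ⟨by simpa [Nat.even_add_one] using hs, hn, ?_⟩⟩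
      exact S.notMem_initialCells_of_notMem fun h =>
        hij (S.eq_of_mem (S.cell_cons_subset _ _ h) hj)
    · obtain ⟨k, hk⟩ := S.exists_mem_initialCells hj hy
      refine ⟨k, j :: s, Or.inr ⟨by simpa using hs.add_one, hk, ?_⟩⟩
      exact S.notMem_initialCells_of_notMem fun h => hij (S.eq_of_mem hi h)
  · obtain hlt' | hgt := lt_or_gt_of_ne hij
    swap
    · exact ⟨j, s, Or.inr ⟨hs, S.mem_initialCells_self hj, S.notMem_initialCells hi hgt⟩⟩
    by_cases hx : x = S.pt (i :: s)
    · have hy : y ≠ S.pt (j :: s) := hlt _ _ (.odd_sibling s i j hs hlt') hx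
      obtain ⟨k, hk⟩ := S.eq_pt_or_mem hj |>.resolve_left hy
      have hy' : y ≠ S.pt (k :: j :: s) := hlt _ _ (.above s k j i hs hlt'.le) hx
      obtain ⟨n, hn⟩ := S.exists_mem_initialCells hk hy'
      refine ⟨n, k :: j :: s, Or.inr ⟨by simpa [Nat.odd_add_one] using hs, hn, ?_⟩⟩
      exact S.notMem_initialCells_of_notMem fun h =>
        hij (S.eq_of_mem hi (S.cell_cons_subset _ _ h))
    · obtain ⟨k, hk⟩ := S.exists_mem_initialCells hi hx
      refine ⟨k, i :: s, Or.inl ⟨by simpa using hs.add_one, hk, ?_⟩⟩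
      exact S.notMem_initialCells_of_notMem fun h => hij (S.eq_of_mem h hj)

theorem priestleySpace : @PriestleySpace X S.partialOrder.toPreorder _ := by
  let _ := S.partialOrder
  refine ⟨fun {x y} hxy => ?_⟩
  obtain ⟨k, l, ⟨hl, hx, hy⟩ | ⟨hl, hy, hx⟩⟩ := S.exists_initialCells_of_not_le hxy
  · exact ⟨_, S.isClopen_initialCells k l, S.isUpperSet_initialCells hl, hx, hy⟩
  · exact ⟨_, (S.isClopen_initialCells k l).compl, (S.isLowerSet_initialCells hl).compl, hx,
      not_not.2 hy⟩

end CellScheme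

/-! ### The component of the root -/

namespace TreePoint

theorem mem_orderComponent_root (s : List ℕ) : (⟨s⟩ : TreePoint) ∈ orderComponent ⟨[]⟩ := by
  induction s with
  | nil => exact mem_orderComponent_self _
  | cons i s ih =>
    cases s with
    | nil => exact mem_orderComponent_of_le ih (Or.inr (.root i))
    | cons m l =>
      rcases Nat.even_or_odd l.length with hl | hl
      · exact mem_orderComponent_of_ge ih (Or.inr (.below l i m m hl le_rfl))
      · exact mem_orderComponent_of_le ih (Or.inr (.above l i m m hl le_rfl))

theorem mem_orderComponent (a b : TreePoint) : b ∈ orderComponent a :=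
  mem_orderComponent_trans (mem_orderComponent_symm (mem_orderComponent_root a.index))
    (mem_orderComponent_root b.index)

theorem index_injective : Function.Injective index := fun ⟨_⟩ ⟨_⟩ h => congrArg mk h

instance : Countable TreePoint := index_injective.countable

instance : Infinite TreePoint :=
  Infinite.of_injective (fun n : ℕ => (⟨[n]⟩ : TreePoint)) fun m n h => by simpa using h

end TreePoint

theorem map_mem_orderComponent {X Y : Type*} [PartialOrder X] [PartialOrder Y] {f : X → Y}
    (hf : Monotone f) {x y : X} (h : y ∈ orderComponent x) : f y ∈ orderComponent (f x) := by
  change Relation.TransGen _ _ _ at h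
  induction h with
  | single h => exact Relation.TransGen.single (h.imp (@hf _ _) (@hf _ _))
  | tail _ h ih => exact Relation.TransGen.tail ih (h.imp (@hf _ _) (@hf _ _))

/-- A chain of comparabilities starting at a distinguished point never leaves the distinguished
points, as all other points are comparable only to themselves; conversely `TreePoint` is connected.
-/
theorem CellScheme.nonempty_orderIso {X : Type*} [TopologicalSpace X] (S : CellScheme X) :
    letI := S.partialOrder
    Nonempty (orderComponent (S.pt []) ≃o TreePoint) := by
  let _ := S.partialOrder
  have hle : ∀ a b : TreePoint, S.pt a.index ≤ S.pt b.index ↔ a ≤ b := by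
    intro a b
    constructor
    · rintro (h | ⟨s, t, hs, ht, h⟩)
      · exact Or.inl (TreePoint.index_injective (S.pt_injective h))
      · rw [← S.pt_injective hs, ← S.pt_injective ht] at h
        exact Or.inr h
    · rintro (rfl | h)
      · exact le_rfl
      · exact Or.inr ⟨_, _, rfl, rfl, h⟩
  let f : TreePoint → X := fun a => S.pt a.index
  have hf : Monotone f := fun a b h => (hle a b).2 h
  let g : TreePoint ↪o orderComponent (S.pt []) :=
    OrderEmbedding.ofMapLEIff (fun a => ⟨S.pt a.index,
      map_mem_orderComponent hf (TreePoint.mem_orderComponent ⟨[]⟩ a)⟩) hle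
  refine ⟨(OrderIso.ofSurjective g ?_).symm⟩
  rintro ⟨y, hy⟩
  suffices ∃ s, y = S.pt s by
    obtain ⟨s, rfl⟩ := this
    exact ⟨⟨s⟩, rfl⟩
  have hstep : ∀ a b : X, (∃ s, a = S.pt s) → (a ≤ b ∨ b ≤ a) → ∃ s, b = S.pt s := by
    rintro a b ⟨s, rfl⟩ ((h | ⟨u, v, h, h', -⟩) | (h | ⟨u, v, h, h', -⟩))
    · exact ⟨s, h.symm⟩
    · exact ⟨v, h'⟩
    · exact ⟨s, h⟩
    · exact ⟨u, h⟩
  change Relation.TransGen _ _ _ at hy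
  induction hy with
  | single h => exact hstep _ _ ⟨_, rfl⟩ h
  | tail _ h ih => exact hstep _ _ ih h

end CellSchemes

/-! ### Construction of cell schemes -/

section ExistenceOfCellSchemes

open Set

theorem isClopen_disjointed {X : Type*} [TopologicalSpace X] {W : ℕ → Set X}
    (hW : ∀ n, IsClopen (W n)) (n : ℕ) : IsClopen (disjointed W n) := by
  rw [disjointed_eq_inter_compl]
  exact (hW n).inter ((finite_Iio n).isClopen_biInter fun i _ => (hW i).compl)

variable {X : Type*} [TopologicalSpace X] {U : ℕ → Set X}

theorem exists_clopen_partition_compl_singleton (hU : ∀ n, IsClopen (U n))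
    (hsep : ∀ x y, (∀ n, x ∈ U n ↔ y ∈ U n) → x = y) (hX : ∀ x : X, ¬ IsOpen {x})
    {K : Set X} (hK : IsClopen K) (hne : K.Nonempty) :
    ∃ p ∈ K, ∃ A : ℕ → Set X, (∀ i, IsClopen (A i)) ∧ (∀ i, (A i).Nonempty) ∧
      (∀ i j x, x ∈ A i → x ∈ A j → i = j) ∧ ⋃ i, A i = K \ {p} := by
  classical
  obtain ⟨p, hp⟩ := hne
  -- `W n` is the part of `K` that `U n` separates from `p`; these sets cover `K \ {p}`, and
  -- `disjointed` turns them into a partition.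
  let W : ℕ → Set X := fun n => if p ∈ U n then K \ U n else K ∩ U n
  have hW : ∀ n, IsClopen (W n) := by
    intro n
    by_cases h : p ∈ U n
    · simpa [W, h] using hK.diff (hU n)
    · simpa [W, h] using hK.inter (hU n)
  have hWmem : ∀ n x, x ∈ W n ↔ x ∈ K ∧ ¬ (x ∈ U n ↔ p ∈ U n) := by
    intro n x
    by_cases h : p ∈ U n <;> simp [W, h]
  have hWU : ⋃ n, W n = K \ {p} := by
    ext x
    simp only [mem_iUnion, hWmem, mem_sdiff, mem_singleton_iff]
    constructor
    · rintro ⟨n, hx, h⟩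
      exact ⟨hx, by rintro rfl; exact h Iff.rfl⟩
    · rintro ⟨hx, h⟩
      by_contra! hn
      exact h (hsep x p fun n => hn n hx)
  have hD := isClopen_disjointed hW
  have hDU : ⋃ n, disjointed W n = K \ {p} := iUnion_disjointed.trans hWU
  have hDd : ∀ i j x, x ∈ disjointed W i → x ∈ disjointed W j → i = j := by
    intro i j x hi hj
    by_contra hij
    exact disjoint_left.1 (disjoint_disjointed W hij) hi hj
  -- With finitely many nonempty pieces `K \ {p}` would be clopen and `p` isolated. Infinitude lets
  -- `Nat.nth` index the nonempty pieces by all of `ℕ`.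
  have hinf : {n | (disjointed W n).Nonempty}.Infinite := by
    intro hfin
    have heq : K \ {p} = ⋃ n ∈ {n | (disjointed W n).Nonempty}, disjointed W n := by
      rw [← hDU]
      ext x
      simp only [mem_iUnion, mem_ofPred_eq, exists_prop]
      exact ⟨fun ⟨n, hn⟩ => ⟨n, ⟨x, hn⟩, hn⟩, fun ⟨n, _, hn⟩ => ⟨n, hn⟩⟩
    have hcl : IsClopen (K \ {p}) := by
      rw [heq]
      exact hfin.isClopen_biUnion fun n _ => hD n
    apply hX p
    have : ({p} : Set X) = K \ (K \ {p}) := by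
      rw [sdiff_sdiff_cancel_left (singleton_subset_iff.2 hp)]
    rw [this]
    exact (hK.diff hcl).isOpen
  refine ⟨p, hp, fun i => disjointed W (Nat.nth (fun n => (disjointed W n).Nonempty) i),
    fun i => hD _, fun i => Nat.nth_mem_of_infinite hinf i,
    fun i j x hi hj => Nat.nth_injective hinf (hDd _ _ x hi hj), ?_⟩
  rw [← hDU]
  ext x
  simp only [mem_iUnion]
  constructor
  · rintro ⟨i, hi⟩
    exact ⟨_, hi⟩
  · rintro ⟨n, hn⟩
    obtain ⟨i, rfl⟩ : n ∈ range (Nat.nth fun n => (disjointed W n).Nonempty) := by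
      rw [Nat.range_nth_of_infinite hinf]
      exact ⟨x, hn⟩
    exact ⟨i, hn⟩

/-- Not splitting `V` within any piece is what will make the cells separate points. If `K` meets
both `V` and its complement, `p` is chosen in `K ∩ V` and `K \ V` becomes piece `0`; otherwise any
partition works. -/
theorem exists_homogeneous_partition_compl_singleton (hU : ∀ n, IsClopen (U n))
    (hsep : ∀ x y, (∀ n, x ∈ U n ↔ y ∈ U n) → x = y) (hX : ∀ x : X, ¬ IsOpen {x})
    {V : Set X} (hV : IsClopen V) {K : Set X} (hK : IsClopen K) (hne : K.Nonempty) :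
    ∃ p ∈ K, ∃ A : ℕ → Set X, (∀ i, IsClopen (A i)) ∧ (∀ i, (A i).Nonempty) ∧
      (∀ i j x, x ∈ A i → x ∈ A j → i = j) ∧ ⋃ i, A i = K \ {p} ∧
      ∀ i x y, x ∈ A i → y ∈ A i → (x ∈ V ↔ y ∈ V) := by
  by_cases h : (K ∩ V).Nonempty ∧ (K \ V).Nonempty
  · obtain ⟨p, hp, A, hA, hAne, hAd, hAU⟩ :=
      exists_clopen_partition_compl_singleton hU hsep hX (hK.inter hV) h.1
    have hAV : ∀ i x, x ∈ A i → x ∈ K ∩ V := fun i x hx =>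
      (hAU.subset (mem_iUnion.2 ⟨i, hx⟩)).1
    refine ⟨p, hp.1, fun i => Nat.casesOn i (K \ V) A, ?_, ?_, ?_, ?_, ?_⟩
    · rintro (_ | i)
      exacts [hK.diff hV, hA i]
    · rintro (_ | i)
      exacts [h.2, hAne i]
    · rintro (_ | i) (_ | j) x hi hj
      · rfl
      · exact absurd (hAV j x hj).2 hi.2
      · exact absurd (hAV i x hi).2 hj.2
      · exact congrArg _ (hAd i j x hi hj)
    · have hrw : ⋃ i, (Nat.casesOn i (K \ V) A : Set X) = (K \ V) ∪ ⋃ i, A i := by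
        ext x
        simp only [mem_iUnion, mem_union]
        constructor
        · rintro ⟨_ | i, hi⟩
          exacts [Or.inl hi, Or.inr ⟨i, hi⟩]
        · rintro (hx | ⟨i, hi⟩)
          exacts [⟨0, hx⟩, ⟨i + 1, hi⟩]
      rw [hrw, hAU]
      ext x
      by_cases hxV : x ∈ V
      · simp [hxV]
      · have : x ≠ p := by rintro rfl; exact hxV hp.2
        simp [hxV, this]
    · rintro (_ | i) x y hx hy
      · exact iff_of_false hx.2 hy.2
      · exact iff_of_true (hAV i x hx).2 (hAV i y hy).2
  · obtain ⟨p, hp, A, hA, hAne, hAd, hAU⟩ :=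
      exists_clopen_partition_compl_singleton hU hsep hX hK hne
    have hAK : ∀ i x, x ∈ A i → x ∈ K := fun i x hx => (hAU.subset (mem_iUnion.2 ⟨i, hx⟩)).1
    refine ⟨p, hp, A, hA, hAne, hAd, hAU, fun i x y hx hy => ?_⟩
    by_contra hxy
    by_cases hxV : x ∈ V
    · exact h ⟨⟨x, hAK i x hx, hxV⟩, ⟨y, hAK i y hy, fun hyV => hxy (iff_of_true hxV hyV)⟩⟩
    · by_cases hyV : y ∈ V
      · exact h ⟨⟨y, hAK i y hy, hyV⟩, ⟨x, hAK i x hx, hxV⟩⟩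
      · exact hxy (iff_of_false hxV hyV)

/-- A nonempty space without isolated points whose points are separated by countably many clopen
sets has a cell scheme. -/
theorem nonempty_cellScheme [Nonempty X] (hU : ∀ n, IsClopen (U n))
    (hsep : ∀ x y, (∀ n, x ∈ U n ↔ y ∈ U n) → x = y) (hX : ∀ x : X, ¬ IsOpen {x}) :
    Nonempty (CellScheme X) := by
  choose p hp A hA hAne hAd hAU hAh using
    fun (n : ℕ) (K : {K : Set X // IsClopen K ∧ K.Nonempty}) =>
      exists_homogeneous_partition_compl_singleton hU hsep hX (hU n) K.2.1 K.2.2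
  let cell : List ℕ → {K : Set X // IsClopen K ∧ K.Nonempty} := fun s =>
    List.rec ⟨univ, isClopen_univ, univ_nonempty⟩
      (fun i s K => ⟨A s.length K i, hA s.length K i, hAne s.length K i⟩) s
  have hcons : ∀ i s, (cell (i :: s)).1 = A s.length (cell s) i := fun i s => rfl
  have hsub : ∀ i s, (cell (i :: s)).1 ⊆ (cell s).1 \ {p s.length (cell s)} := by
    intro i s
    rw [hcons, ← hAU]
    exact subset_iUnion _ i
  refine ⟨⟨fun s => (cell s).1, fun s => p s.length (cell s), fun s => (cell s).2.1, rfl,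
    fun s => hp _ _, fun i s x hx => (hsub i s hx).1, fun i s hx => (hsub i s hx).2 rfl, ?_, ?_,
    ?_⟩⟩
  · intro i j s x hi hj
    exact hAd _ _ i j x hi hj
  · intro s x hx
    by_cases h : x = p s.length (cell s)
    · exact Or.inl h
    · have : x ∈ ⋃ i, A s.length (cell s) i := by
        rw [hAU]
        exact ⟨hx, h⟩
      exact Or.inr (mem_iUnion.1 this)
  · intro x y hxy
    obtain ⟨n, hn⟩ : ∃ n, ¬ (x ∈ U n ↔ y ∈ U n) := by
      by_contra! h
      exact hxy (hsep x y h)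
    -- The children of a node of length `n` are homogeneous for `U n`, so the separation shows one
    -- level later.
    refine ⟨n + 1, ?_⟩
    rintro (_ | ⟨i, s⟩) hs hx hy
    · simp at hs
    · have hs' : s.length = n := by simpa using hs
      subst hs'
      exact hn (hAh _ _ i x y hx hy)

end ExistenceOfCellSchemes

/-! ### The space of cuts -/

namespace CutSpace

open Set

/-- A cut as a decreasing set. -/
def toLowerSet (x : CutSpace) : LowerSet (Ioo (0 : ℚ) 1) := x

/-- The set of all cuts that contain `q`. -/
def containing (q : Ioo (0 : ℚ) 1) : Set CutSpace := {x | q ∈ x.toLowerSet}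

theorem mem_containing {q : Ioo (0 : ℚ) 1} {x : CutSpace} :
    x ∈ containing q ↔ q ∈ x.toLowerSet := Iff.rfl

/-- A cut contains `q` iff it lies above `LowerSet.Iic q`, and also iff it does not lie below
`LowerSet.Iio q`; so both the set and its complement are complements of subbasic closed sets or such
sets themselves. -/
theorem isClopen_containing (q : Ioo (0 : ℚ) 1) : IsClopen (containing q) := by
  constructor
  · have : (containing q)ᶜ = (toLowerSet ⁻¹' Ici (LowerSet.Iic q))ᶜ := by
      ext x
      refine not_congr ⟨fun hx r hr => x.toLowerSet.lower hr hx, fun hx => hx (le_refl q)⟩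
    rw [← isOpen_compl_iff, this]
    exact TopologicalSpace.isOpen_generateFrom_of_mem (Or.inr ⟨_, rfl⟩)
  · have : containing q = (toLowerSet ⁻¹' Iic (LowerSet.Iio q))ᶜ := by
      ext x
      constructor
      · intro hx hle
        exact lt_irrefl q (LowerSet.mem_Iio_iff.1 (hle (mem_containing.1 hx)))
      · intro hx
        by_contra hq
        refine hx fun r hr => lt_of_not_ge fun hqr => hq (x.toLowerSet.lower hqr hr)
    rw [this]
    exact TopologicalSpace.isOpen_generateFrom_of_mem (Or.inl ⟨_, rfl⟩)

theorem eq_of_containing {x y : CutSpace} (h : ∀ q, x ∈ containing q ↔ y ∈ containing q) : x = y :=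
  SetLike.ext (p := x.toLowerSet) (q := y.toLowerSet) h

instance : CompactSpace CutSpace :=
  compactSpace_intervalTopology_of_completeLattice (LowerSet (Ioo (0 : ℚ) 1))

theorem exists_between_finsets (s t : Finset (Ioo (0 : ℚ) 1)) (h : ∀ a ∈ s, ∀ b ∈ t, a < b) :
    ∃ c, (∀ a ∈ s, a < c) ∧ ∀ b ∈ t, c < b := by
  have : Nonempty (Ioo (0 : ℚ) 1) := ⟨⟨1 / 2, by norm_num, by norm_num⟩⟩
  exact Order.exists_between_finsets s t h

/-- By compactness, an isolated cut would be determined by its membership values on a finite set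
`F`. Density yields `c < d` above the points of `F` in `p` and below the others, and the distinct
principal cuts at `c` and `d` agree with `p` on `F`. -/
theorem not_isOpen_singleton (p : CutSpace) : ¬ IsOpen {p} := by
  classical
  intro hp
  let Z : Ioo (0 : ℚ) 1 → Set CutSpace := fun q =>
    if p ∈ containing q then containing q else (containing q)ᶜ
  have hZmem : ∀ q x, x ∈ Z q ↔ (x ∈ containing q ↔ p ∈ containing q) := by
    intro q x
    by_cases h : p ∈ containing q <;> simp [Z, h]
  have hZ : ∀ q, IsClosed (Z q) := by
    intro q
    by_cases h : p ∈ containing q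
    · simpa [Z, h] using (isClopen_containing q).isClosed
    · simpa [Z, h] using (isClopen_containing q).isOpen
  obtain ⟨F, hF⟩ := hp.isClosed_compl.isCompact.elim_finite_subfamily_closed Z hZ (by
    rw [eq_empty_iff_forall_notMem]
    rintro x ⟨hx, hxZ⟩
    exact hx (eq_of_containing fun q => (hZmem q x).1 (mem_iInter.1 hxZ q)))
  have hall : ∀ x : CutSpace, (∀ q ∈ F, x ∈ containing q ↔ p ∈ containing q) → x = p := by
    intro x hx
    by_contra hxp
    have : x ∈ ({p}ᶜ ∩ ⋂ q ∈ F, Z q : Set CutSpace) :=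
      ⟨hxp, mem_iInter₂.2 fun q hq => (hZmem q x).2 (hx q hq)⟩
    rw [hF] at this
    exact this
  let s := F.filter fun q => p ∈ containing q
  let t := F.filter fun q => p ∉ containing q
  have hst : ∀ a ∈ s, ∀ b ∈ t, a < b := by
    intro a ha b hb
    refine lt_of_not_ge fun hba => (Finset.mem_filter.1 hb).2 ?_
    exact p.toLowerSet.lower hba (Finset.mem_filter.1 ha).2
  obtain ⟨c, hsc, hct⟩ := exists_between_finsets s t hst
  obtain ⟨d, hcd, hdt⟩ := exists_between_finsets {c} t (by simpa using hct)
  replace hcd : c < d := hcd c (by simp)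
  have hprin : ∀ e : Ioo (0 : ℚ) 1, c ≤ e → (∀ b ∈ t, e < b) →
      (LowerSet.Iic e : CutSpace) = p := by
    intro e hce het
    refine hall _ fun q hq => ?_
    by_cases hqp : p ∈ containing q
    · exact iff_of_true (mem_containing.2 <| LowerSet.mem_Iic_iff.2 <|
        (hsc q (Finset.mem_filter.2 ⟨hq, hqp⟩)).le.trans hce) hqp
    · exact iff_of_false (fun h => (het q (Finset.mem_filter.2 ⟨hq, hqp⟩)).not_ge
        (LowerSet.mem_Iic_iff.1 (mem_containing.1 h))) hqp
  have heq : (LowerSet.Iic c : LowerSet (Ioo (0 : ℚ) 1)) = LowerSet.Iic d :=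
    (hprin c le_rfl hct).trans (hprin d hcd.le hdt).symm
  have : d ∈ LowerSet.Iic c := heq ▸ LowerSet.mem_Iic_iff.2 le_rfl
  exact hcd.not_ge (LowerSet.mem_Iic_iff.1 this)

theorem nonempty_cellScheme : Nonempty (CellScheme CutSpace) := by
  have : Nonempty (Ioo (0 : ℚ) 1) := ⟨⟨1 / 2, by norm_num, by norm_num⟩⟩
  obtain ⟨q, hq⟩ := exists_surjective_nat (Ioo (0 : ℚ) 1)
  have : Nonempty CutSpace := ⟨(⊥ : LowerSet (Ioo (0 : ℚ) 1))⟩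
  exact _root_.nonempty_cellScheme (U := fun n => containing (q n))
    (fun n => isClopen_containing _)
    (fun x y h => eq_of_containing (hq.forall.2 h)) not_isOpen_singleton

theorem exists_partialOrder : ∃ _ : PartialOrder CutSpace,
    IsPriestleyTopology CutSpace.instTopologicalSpace ∧ Representable CutSpace ∧
      ∃ x : CutSpace, Nonempty (orderComponent x ≃o TreePoint) := by
  obtain ⟨S⟩ := nonempty_cellScheme
  let _ := S.partialOrder
  have h : IsPriestleyTopology CutSpace.instTopologicalSpace :=
    ⟨inferInstance, S.priestleySpace⟩
  exact ⟨S.partialOrder, h, h.representable, _, S.nonempty_orderIso⟩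

end CutSpace

/-! ### Nonexistence of a Priestley topology on `TreePoint` -/

section

open Set

/-- A point is not isolated in a compact space if it is the only common point of closed sets, each
of which contains almost all terms of a sequence of other points. -/
theorem not_isOpen_singleton_of_iInter_subset {X : Type*} [TopologicalSpace X] [CompactSpace X]
    {a : X} {f : ℕ → X} {F : ℕ → Set X} (hf : ∀ n, f n ≠ a) (hF : ∀ n, IsClosed (F n))
    (hfF : ∀ n m, n ≤ m → f m ∈ F n) (hFa : ⋂ n, F n ⊆ {a}) : ¬ IsOpen {a} := by
  intro ha
  obtain ⟨s, hs⟩ := ha.isClosed_compl.isCompact.elim_finite_subfamily_closed F hF (by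
    rw [eq_empty_iff_forall_notMem]
    exact fun x hx => hx.1 (hFa hx.2))
  obtain ⟨m, hm⟩ := s.bddAbove
  have : f m ∈ ({a}ᶜ ∩ ⋂ n ∈ s, F n : Set X) :=
    ⟨hf m, mem_iInter₂.2 fun n hn => hfF n m (hm hn)⟩
  rw [hs] at this
  exact this

/-- The closed intervals from `f n` to `a` shrink to `a`, and each contains a tail of the sequence.
-/
theorem PriestleySpace.not_isOpen_singleton_of_isLUB {X : Type*} [TopologicalSpace X]
    [CompactSpace X] [PartialOrder X] [PriestleySpace X] {a : X} {f : ℕ → X} (hf : ∀ n, f n ≠ a)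
    (hmono : Monotone f) (ha : IsLUB (range f) a) : ¬ IsOpen {a} := by
  refine not_isOpen_singleton_of_iInter_subset (F := fun n => Ici (f n) ∩ Iic a) hf
    (fun n => (isClosed_Ici _).inter (isClosed_Iic _))
    (fun n m h => ⟨hmono h, ha.1 ⟨m, rfl⟩⟩) fun x hx => ?_
  rw [mem_iInter] at hx
  refine le_antisymm (hx 0).2 (ha.2 ?_)
  rintro _ ⟨n, rfl⟩
  exact (hx n).1

theorem PriestleySpace.not_isOpen_singleton_of_isGLB {X : Type*} [TopologicalSpace X]
    [CompactSpace X] [PartialOrder X] [PriestleySpace X] {a : X} {f : ℕ → X} (hf : ∀ n, f n ≠ a)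
    (hmono : Antitone f) (ha : IsGLB (range f) a) : ¬ IsOpen {a} := by
  refine not_isOpen_singleton_of_iInter_subset (F := fun n => Iic (f n) ∩ Ici a) hf
    (fun n => (isClosed_Iic _).inter (isClosed_Ici _))
    (fun n m h => ⟨hmono h, ha.1 ⟨m, rfl⟩⟩) fun x hx => ?_
  rw [mem_iInter] at hx
  refine le_antisymm (ha.2 ?_) (hx 0).2
  rintro _ ⟨n, rfl⟩
  exact (hx n).1

namespace TreePoint

/-- The `i`-th child of a point. -/
def child (a : TreePoint) (i : ℕ) : TreePoint := ⟨i :: a.index⟩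

theorem child_ne (a : TreePoint) (i : ℕ) : a.child i ≠ a := by
  intro h
  have := congrArg (fun b => b.index.length) h
  simp [child] at this

theorem antitone_child {a : TreePoint} (ha : Even a.index.length) : Antitone a.child := by
  intro i j hij
  obtain rfl | h := hij.eq_or_lt
  · exact le_rfl
  · exact Or.inr (.even_sibling _ _ _ ha h)

theorem monotone_child {a : TreePoint} (ha : Odd a.index.length) : Monotone a.child := by
  intro i j hij
  obtain rfl | h := hij.eq_or_lt
  · exact le_rfl
  · exact Or.inr (.odd_sibling _ _ _ ha h)

theorem Lt.lt_of_even {s : List ℕ} {i j : ℕ} (h : Lt (i :: s) (j :: s)) (hs : Even s.length) :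
    j < i := by
  cases h with
  | even_sibling _ _ _ _ h => exact h
  | odd_sibling _ _ _ h _ => exact absurd hs (Nat.not_even_iff_odd.2 h)

theorem Lt.lt_of_odd {s : List ℕ} {i j : ℕ} (h : Lt (i :: s) (j :: s)) (hs : Odd s.length) :
    i < j := by
  cases h with
  | even_sibling _ _ _ h _ => exact absurd hs (Nat.not_odd_iff_even.2 h)
  | odd_sibling _ _ _ _ h => exact h

theorem Lt.le_of_below {s : List ℕ} {i m k : ℕ} (h : Lt (i :: m :: s) (k :: s)) : k ≤ m := by
  generalize hu : i :: m :: s = u at h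
  generalize hv : k :: s = v at h
  have hlen := congrArg List.length hu
  have hlen' := congrArg List.length hv
  cases h with
  | root => simp at hu
  | even_sibling | odd_sibling => simp at hlen hlen'; omega
  | below l i' m' k' _ h =>
    cases hu
    cases hv
    exact h
  | above => simp at hlen hlen'; omega

theorem Lt.le_of_above {s : List ℕ} {i m k : ℕ} (h : Lt (k :: s) (i :: m :: s)) : k ≤ m := by
  generalize hu : i :: m :: s = u at h
  generalize hv : k :: s = v at h
  have hlen := congrArg List.length hu
  have hlen' := congrArg List.length hv
  cases h with
  | root => simp at hu
  | even_sibling | odd_sibling => simp at hlen hlen'; omega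
  | below => simp at hlen hlen'; omega
  | above l i' m' k' _ h =>
    cases hu
    cases hv
    exact h

/-- A lower bound of all children is not a child, as the children strictly decrease, and not a child
of child `m`, as it would fail to lie below child `m + 1`. What remains below child `0` is `a` and
points below `a`. -/
theorem isGLB_range_child {a : TreePoint} (ha : Even a.index.length) :
    IsGLB (range a.child) a := by
  obtain ⟨s⟩ := a
  replace ha : Even s.length := ha
  constructor
  · rintro _ ⟨i, rfl⟩
    cases s with
    | nil => exact Or.inr (.root i)
    | cons m l => exact Or.inr (.above l i m m (by simpa [Nat.even_add_one] using ha) le_rfl)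
  · rintro ⟨t⟩ ht
    have key : ∀ i, t = i :: s ∨ Lt t (i :: s) := fun i =>
      (ht ⟨i, rfl⟩ : _ ∨ _).imp (congrArg index) id
    have hsib : ∀ k, t ≠ k :: s := by
      rintro k rfl
      obtain h | h := key (k + 1)
      · simp at h
      · have := h.lt_of_even ha
        omega
    have h := (key 0).resolve_left (hsib 0)
    generalize hu : 0 :: s = u at h
    cases h with
    | root i => cases hu; exact le_rfl
    | even_sibling l i j hl h => cases hu; exact absurd rfl (hsib i)
    | odd_sibling l i j hl h => cases hu; exact absurd ha (Nat.not_even_iff_odd.2 hl)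
    | below l i m k hl h =>
      cases hu
      obtain h | h := key (m + 1)
      · simpa using congrArg List.length h
      · have := h.le_of_below
        omega
    | above l i m k hl h =>
      cases hu
      obtain rfl | h := h.eq_or_lt
      · exact le_rfl
      · exact Or.inr (.odd_sibling l k m hl h)

theorem isLUB_range_child {a : TreePoint} (ha : Odd a.index.length) :
    IsLUB (range a.child) a := by
  obtain ⟨s⟩ := a
  replace ha : Odd s.length := ha
  constructor
  · rintro _ ⟨i, rfl⟩
    cases s with
    | nil => simp at ha
    | cons m l => exact Or.inr (.below l i m m (by simpa [Nat.odd_add_one] using ha) le_rfl)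
  · rintro ⟨t⟩ ht
    have key : ∀ i, i :: s = t ∨ Lt (i :: s) t := fun i =>
      (ht ⟨i, rfl⟩ : _ ∨ _).imp (congrArg index) id
    have hsib : ∀ k, k :: s ≠ t := by
      rintro k rfl
      obtain h | h := key (k + 1)
      · simp at h
      · have := h.lt_of_odd ha
        omega
    have h := (key 0).resolve_left (hsib 0)
    generalize hu : 0 :: s = u at h
    cases h with
    | root i => cases hu
    | even_sibling l i j hl h => cases hu; exact absurd ha (Nat.not_odd_iff_even.2 hl)
    | odd_sibling l i j hl h => cases hu; exact absurd rfl (hsib j)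
    | below l i m k hl h =>
      cases hu
      obtain rfl | h := h.eq_or_lt
      · exact le_rfl
      · exact Or.inr (.even_sibling l m k hl h)
    | above l i m k hl h =>
      cases hu
      obtain h | h := key (m + 1)
      · simpa using congrArg List.length h
      · have := h.le_of_above
        omega

/-- By Baire, one of the countably many closed singletons has nonempty interior, yet the children of
each point approach it. -/
theorem not_isPriestleyTopology (τ : TopologicalSpace TreePoint) : ¬ IsPriestleyTopology τ := by
  rintro ⟨hc, hp⟩
  obtain ⟨a, ha⟩ := nonempty_interior_of_iUnion_of_closed
    (f := fun a : TreePoint => {a}) (fun a => isClosed_singleton) (iUnion_of_singleton _)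
  have hopen : IsOpen {a} := by
    obtain h | h := subset_singleton_iff_eq.1 (interior_subset (s := {a}))
    · exact absurd ha (by rw [h]; exact not_nonempty_empty)
    · exact h ▸ isOpen_interior
  rcases Nat.even_or_odd a.index.length with h | h
  · exact PriestleySpace.not_isOpen_singleton_of_isGLB a.child_ne (antitone_child h)
      (isGLB_range_child h) hopen
  · exact PriestleySpace.not_isOpen_singleton_of_isLUB a.child_ne (monotone_child h)
      (isLUB_range_child h) hopen

theorem not_representable {X : Type u} [PartialOrder X] (e : TreePoint ≃o X) :
    ¬ Representable X := by
  intro h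
  obtain ⟨τ, hτ⟩ := h.exists_isPriestleyTopology
  exact not_isPriestleyTopology _ (hτ.induced e)

end TreePoint

theorem orderComponent_orderIso {X Y : Type*} [PartialOrder X] [PartialOrder Y] (e : X ≃o Y)
    (x : X) : Nonempty (orderComponent x ≃o orderComponent (e x)) := by
  let f : orderComponent x ↪o orderComponent (e x) :=
    OrderEmbedding.ofMapLEIff (fun y => ⟨e y.1, map_mem_orderComponent e.monotone y.2⟩)
      fun a b => e.le_iff_le
  refine ⟨OrderIso.ofSurjective f ?_⟩
  rintro ⟨y, hy⟩
  refine ⟨⟨e.symm y, ?_⟩, Subtype.ext (e.apply_symm_apply y)⟩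
  simpa using map_mem_orderComponent e.symm.monotone hy

theorem exists_representable_not_representable_orderComponent :
    ∃ (X : Type u) (_ : PartialOrder X), Representable X ∧
      ∃ x : X, ¬ Representable (orderComponent x) := by
  obtain ⟨_, h, -, x, ⟨e⟩⟩ := CutSpace.exists_partialOrder
  -- `CutSpace` lives in the lowest universe, so it is lifted to universe `u`.
  let u : ULift.{u} CutSpace ≃o CutSpace := { Equiv.ulift with map_rel_iff' := Iff.rfl }
  obtain ⟨e'⟩ := orderComponent_orderIso u (u.symm x)
  rw [u.apply_symm_apply] at e'
  exact ⟨ULift.{u} CutSpace, inferInstance, (h.induced u).representable, u.symm x,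
    TreePoint.not_representable (e'.trans e).symm⟩

end

theorem theorem1p1 :
    -- a poset whose order components are representable is representable
    (∀ (X : Type u) [PartialOrder X],
      (∀ x : X, Representable (orderComponent x)) → Representable X) ∧
    -- the order components of a representable poset are compact in their interval topologies
    (∀ (X : Type u) [PartialOrder X], Representable X →
      ∀ x : X, @CompactSpace (orderComponent x) (intervalTopology (orderComponent x))) ∧
    -- some representable poset has an order component that is not representable
    (∃ (X : Type u) (_ : PartialOrder X), Representable X ∧
      ∃ x : X, ¬ Representable (orderComponent x)) ∧
    -- the poset `TreePoint` is countably infinite and connected, and is an order component of a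
    -- Priestley order on `CutSpace`, which is therefore a representable poset
    Countable TreePoint ∧ Infinite TreePoint ∧
    (∀ a b : TreePoint, b ∈ orderComponent a) ∧
    (∃ _ : PartialOrder CutSpace,
      IsPriestleyTopology CutSpace.instTopologicalSpace ∧ Representable CutSpace ∧
      ∃ x : CutSpace, Nonempty (orderComponent x ≃o TreePoint)) ∧
    -- but it carries no Priestley topology, and is not representable
    (¬ ∃ τ : TopologicalSpace TreePoint, IsPriestleyTopology τ) ∧
    ¬ Representable TreePoint := by

  refine ⟨fun X _ h => representable_of_forall_orderComponent h,
    fun X _ h x => h.compactSpace_orderComponent x,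
    exists_representable_not_representable_orderComponent, inferInstance, inferInstance,
    TreePoint.mem_orderComponent, CutSpace.exists_partialOrder,
    fun ⟨τ, h⟩ => TreePoint.not_isPriestleyTopology τ h,
    TreePoint.not_representable (OrderIso.refl _)⟩
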